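/- Let $G$ be a finite connected planar multigraph (loops and parallel edges allowed) with $n$ vertices and $m$ edges, with a planar embedding given by its rotation system, i.e. by the counter-clockwise cyclic order of the edge-ends around each vertex, such that $n-m+f=2$ for the number $f$ of faces. Let $T$ be a spanning tree of $G$. Then the edges dual to the edges of $G$ not in $T$ form a spanning tree $T^*$ of the dual of $G$. Choose any face as the outer face, any vertex $r$ on it, and any incidence (corner) of the outer face at $r$. Perform the depth-first traversal of $T$ from $r$ that processes all the edge-ends at each visited vertex $v$ in counter-clockwise order, starting with the one immediately after the chosen incidence of the outer face if $v=r$, and with the one immediately after the edge to the parent of $v$ in $T$ otherwise; when an edge of $T$ to a child is processed, the child is visited before the traversal continues at $v$, and the last edge processed at the child is the one back to $v$; an edge not in $T$ is processed without moving. Perform the depth-first traversal of $T^*$ from the vertex of the dual that corresponds to the outer face in the same way, but in clockwise order (from right to left), starting at the same incidence. Both traversals are well defined, and the first processes every edge of $G$ exactly twice, once from each of its ends. The sequence of the edges not in $T$ processed in the traversal of $T$ (each appears twice) is exactly the sequence of the edges whose duals are crossed in the traversal of $T^*$, with the same directions: each time an edge not in $T$ is processed from one of its ends, its dual is crossed from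 the face on the right to the face on the left, as seen from this end. Consequently, let $B^*$ be the sequence of bits obtained by writing, each time the traversal of $T$ processes an edge not in $T$, the bit $0$ if this is the first time that this edge is processed and the bit $1$ if it is the second time. Then $0\,B^*\,1$ is the balanced-parentheses representation ($0$ for an opening and $1$ for a closing parenthesis) of $T^*$ rooted at the outer face and traversed from right to left, i.e. with the children of each node in clockwise order, starting at the chosen incidence at the root and immediately after the edge to the parent at every other node. -/

import Mathlib

/-! Finite multigraphs, possibly with loops and parallel edges. -/

/-- A multigraph with vertex type `V` and edge type `E`: edge `e` has the two ends
`ends e false` and `ends e true`, which coincide for a loop. -/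
structure Multigraph (V E : Type*) where
  ends : E → Bool → V

/-- A dart (an edge-end): `(e, b)` is the edge `e` leaving its end `ends e b`.
Every edge, also a loop, has exactly two darts. -/
abbrev Dart (E : Type*) := E × Bool

/-- The other dart of the same edge, as a permutation of the darts. -/
def Dart.rev (E : Type*) : Equiv.Perm (Dart E) where
  toFun d := (d.1, !d.2)
  invFun d := (d.1, !d.2)
  left_inv := by rintro ⟨e, b⟩; simp
  right_inv := by rintro ⟨e, b⟩; simp

namespace Multigraph

variable {V E : Type*}

/-- The vertex that a dart leaves. -/
def src (G : Multigraph V E) (d : Dart E) : V := G.ends d.1 d.2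

/-- The vertex that a dart leads to. -/
def tgt (G : Multigraph V E) (d : Dart E) : V := G.src (Dart.rev E d)

/-- `w` can be reached from `v` along edges of `S`. -/
def ReachableIn (G : Multigraph V E) (S : Set E) : V → V → Prop :=
  Relation.ReflTransGen (fun v w => ∃ d : Dart E, d.1 ∈ S ∧ G.src d = v ∧ G.tgt d = w)

/-- The subgraph with all the vertices of `G` and the edge set `S` is connected. -/
def ConnectedBy (G : Multigraph V E) (S : Set E) : Prop :=
  Nonempty V ∧ ∀ v w : V, G.ReachableIn S v w

/-- `G` is connected. -/
def Connected (G : Multigraph V E) : Prop := G.ConnectedBy Set.univ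

/-- The darts of `l`, in this cyclic order, form a cycle of `G`: each leads to the vertex that the
next one leaves, and no edge and no vertex is repeated. (A loop is a cycle of length one, two
parallel edges form a cycle of length two.) -/
def IsCycle (G : Multigraph V E) (l : List (Dart E)) : Prop :=
  l ≠ [] ∧ Cycle.Chain (fun d d' => G.tgt d = G.src d') (l : Cycle (Dart E)) ∧
    (l.map Prod.fst).Nodup ∧ (l.map G.src).Nodup

/-- `T` is the edge set of a spanning tree of `G`: the subgraph with all the vertices and the
edges `T` is connected and contains no cycle. -/
def IsSpanningTree (G : Multigraph V E) (T : Set E) : Prop :=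
  G.ConnectedBy T ∧ ∀ l : List (Dart E), G.IsCycle l → ¬ ∀ d ∈ l, d.1 ∈ T

/-- An isolated vertex: no dart leaves it. -/
def IsIsolated (G : Multigraph V E) (v : V) : Prop := ∀ d : Dart E, G.src d ≠ v

end Multigraph

/-! Embeddings in an oriented surface, faces and duals. -/

/-- A (cellular) embedding of `G` in an oriented surface, given by its rotation system: `rot d` is
the dart that follows `d` in counter-clockwise order around the vertex that `d` leaves. The cycles
of `rot` are exactly the sets of darts leaving the same vertex. -/
structure Embedding {V E : Type*} (G : Multigraph V E) where
  rot : Equiv.Perm (Dart E)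
  src_eq_iff : ∀ d d' : Dart E, G.src d = G.src d' ↔ rot.SameCycle d d'

namespace Embedding

variable {V E : Type*} {G : Multigraph V E}

/-- The face permutation. Walking along `d` with a face on the right-hand side and continuing
along the boundary of that face (clockwise around the face), the next dart is
the one just after `rev d` in counter-clockwise order. -/
def facePerm (M : Embedding G) : Equiv.Perm (Dart E) := M.rot * Dart.rev E

/-- The faces: the cycles of the face permutation, the cycle of `d` being the face to the right of
`d`; and, at each isolated vertex, the one face around it. -/
def Face (M : Embedding G) : Type _ :=
  Quotient (Equiv.Perm.SameCycle.setoid M.facePerm) ⊕ {v : V // G.IsIsolated v}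

/-- The face to the right of a dart. -/
def rightFace (M : Embedding G) (d : Dart E) : M.Face :=
  Sum.inl (Quotient.mk (Equiv.Perm.SameCycle.setoid M.facePerm) d)

/-- The embedding of a connected finite multigraph is planar (its surface is the sphere, that is,
the plane together with a point at infinity) if Euler's formula `|V| - |E| + |F| = 2` holds. -/
def IsPlanar (M : Embedding G) : Prop :=
  Nat.card V + Nat.card M.Face = Nat.card E + 2

/-- The corners, i.e. the incidences between vertices and faces: `Sum.inl d` is the corner between
`rot⁻¹ d` and `d` at the vertex that `d` leaves; an isolated vertex has one corner. -/
abbrev Corner (_M : Embedding G) := Dart E ⊕ {v : V // G.IsIsolated v}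

/-- The vertex at which a corner lies. -/
def cornerVertex (M : Embedding G) : M.Corner → V
  | Sum.inl d => G.src d
  | Sum.inr v => v.1

/-- The face in which a corner lies. -/
def cornerFace (M : Embedding G) : M.Corner → M.Face
  | Sum.inl d => M.rightFace d
  | Sum.inr v => Sum.inr v

/-- The dual multigraph: its vertices are the faces, it has an edge `e` for every edge `e` of `G`,
and its dart `d` crosses the dart `d` of `G` from right to left. -/
def dualGraph (M : Embedding G) : Multigraph M.Face E where
  ends e b := M.rightFace (e, b)

/-- The dual embedding: as the face permutation goes clockwise around every face, its inverse is
the counter-clockwise rotation around the dual vertices. -/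
def dual (M : Embedding G) : Embedding M.dualGraph where
  rot := M.facePerm⁻¹
  src_eq_iff d d' := by
    rw [Equiv.Perm.sameCycle_inv]
    exact Sum.inl_injective.eq_iff.trans Quotient.eq

/-- A corner of an embedding, seen as a corner of the dual embedding. -/
def dualCorner (M : Embedding G) : M.Corner → M.dual.Corner
  | Sum.inl d => Sum.inl (M.facePerm⁻¹ d)
  | Sum.inr v => Sum.inr ⟨Sum.inr v, fun _ h => Sum.inl_ne_inr h⟩

/-- The vertex of the dual at which a corner lies is the face in which it lies. -/
theorem cornerVertex_dualCorner (M : Embedding G) (c : M.Corner) :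
    M.dual.cornerVertex (M.dualCorner c) = M.cornerFace c := by
  cases c with
  | inr v => rfl
  | inl d =>
    refine congrArg Sum.inl (Quotient.sound ?_)
    exact ⟨1, by simp⟩

end Embedding

/-! Depth-first traversals of trees in embedded graphs. -/

section Traversal

variable {V E : Type*} {G : Multigraph V E}

/-- The darts of the cycle of `d` under `ρ`, each once: `d, ρ d, ρ (ρ d), …`. -/
noncomputable def dartRound (ρ : Equiv.Perm (Dart E)) (d : Dart E) : List (Dart E) :=
  (List.range (Function.minimalPeriod ρ d)).map (fun i => ρ^[i] d)

/-- `Processes ρ T ds L`: a depth-first traversal of the tree with edge set `T`, which has reached a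
vertex where the darts `ds` are still to be processed, in this order, processes from
there on exactly the darts `L`, in this order, until it is done with `ds`. A dart whose edge is not
in `T` is only processed. When a dart `d` with its edge in `T` is processed, the traversal moves
along `d` to a child, processes all the other darts there, in the order `ρ` and starting with the
one immediately after the dart `rev d` to the parent, and then processes `rev d`
and is back at the parent. -/
inductive Processes (ρ : Equiv.Perm (Dart E)) (T : Set E) :
    List (Dart E) → List (Dart E) → Prop
  | nil : Processes ρ T [] []
  | skip {d : Dart E} {ds L : List (Dart E)} (h : d.1 ∉ T) (hL : Processes ρ T ds L) :
      Processes ρ T (d :: ds) (d :: L)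
  | visit {d : Dart E} {ds L₁ L₂ : List (Dart E)} (h : d.1 ∈ T)
      (h₁ : Processes ρ T (dartRound ρ (Dart.rev E d)).tail L₁) (h₂ : Processes ρ T ds L₂) :
      Processes ρ T (d :: ds) (d :: (L₁ ++ Dart.rev E d :: L₂))

/-- A rooted ordered tree: a root with the list of the subtrees of its children. -/
inductive OrderedTree
  | node (children : List OrderedTree) : OrderedTree

mutual

/-- The balanced-parentheses representation of an ordered tree: `false` (the bit 0) is written when
a node is first visited, `true` (the bit 1) when it is left for the last time. -/
def OrderedTree.parens : OrderedTree → List Bool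
  | .node ts => false :: (OrderedTree.forestParens ts ++ [true])

/-- The concatenated balanced-parentheses representations of a list of ordered trees. -/
def OrderedTree.forestParens : List OrderedTree → List Bool
  | [] => []
  | t :: ts => t.parens ++ OrderedTree.forestParens ts

end

/-- `Subtrees ρ T ds ts`: the subtrees hanging from a vertex through those of its darts `ds` that
lie in the tree with edge set `T`, in this order, are `ts`, where the children of every
further vertex are ordered by `ρ`, starting immediately after the dart to the parent. -/
inductive Subtrees (ρ : Equiv.Perm (Dart E)) (T : Set E) :
    List (Dart E) → List OrderedTree → Prop
  | nil : Subtrees ρ T [] []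
  | skip {d : Dart E} {ds : List (Dart E)} {ts : List OrderedTree} (h : d.1 ∉ T)
      (hs : Subtrees ρ T ds ts) : Subtrees ρ T (d :: ds) ts
  | child {d : Dart E} {ds : List (Dart E)} {ts₁ ts₂ : List OrderedTree} (h : d.1 ∈ T)
      (h₁ : Subtrees ρ T (dartRound ρ (Dart.rev E d)).tail ts₁) (h₂ : Subtrees ρ T ds ts₂) :
      Subtrees ρ T (d :: ds) (OrderedTree.node ts₁ :: ts₂)

namespace Embedding

/-- The darts at the vertex of a corner, in counter-clockwise order from that corner. -/
noncomputable def ccwFrom (M : Embedding G) : M.Corner → List (Dart E)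
  | Sum.inl d => dartRound M.rot d
  | Sum.inr _ => []

/-- The darts at the vertex of a corner, in clockwise order from that corner. -/
noncomputable def cwFrom (M : Embedding G) : M.Corner → List (Dart E)
  | Sum.inl d => dartRound M.rot⁻¹ (M.rot⁻¹ d)
  | Sum.inr _ => []

/-- `L` lists the darts processed in the depth-first traversal of the tree `T` that starts at the
corner `c` of its root and processes the edges at every vertex in counter-clockwise order
(left to right). -/
def IsCcwTraversal (M : Embedding G) (T : Set E) (c : M.Corner) (L : List (Dart E)) : Prop :=
  Processes M.rot T (M.ccwFrom c) L

/-- `L` lists the darts processed in the depth-first traversal of the tree `T` that starts at the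
corner `c` of its root and processes the edges at every vertex in clockwise order
(right to left). -/
def IsCwTraversal (M : Embedding G) (T : Set E) (c : M.Corner) (L : List (Dart E)) : Prop :=
  Processes M.rot⁻¹ T (M.cwFrom c) L

/-- `t` is the tree `T` as an ordered tree, rooted at the vertex of the corner `c`, with the
children of every vertex in clockwise order (right to left), starting at the corner `c` at the root
and immediately after the edge to the parent at every other vertex. -/
def IsCwOrderedTree (M : Embedding G) (T : Set E) (c : M.Corner) (t : OrderedTree) : Prop :=
  ∃ ts : List OrderedTree, Subtrees M.rot⁻¹ T (M.cwFrom c) ts ∧ t = OrderedTree.node ts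

end Embedding

open Classical in
/-- The sublist of the darts whose edges are in `S`. -/
noncomputable def dartsIn (S : Set E) (L : List (Dart E)) : List (Dart E) :=
  L.filter (fun d => decide (d.1 ∈ S))

open Classical in
/-- Replaces every entry of a list by `false` (the bit 0) if it is the first occurrence of this
entry, and by `true` (the bit 1) if the entry has occurred before. -/
noncomputable def occurrenceBits (l : List E) : List Bool :=
  l.mapIdx (fun i e => decide (e ∈ l.take i))

end Traversal

-- Both traversals are the same orbit of one permutation of the darts. In the traversal of a tree
-- `T` with rotation `ρ`, the dart after `d` is `ρ d` if the edge of `d` is not in `T`, and `ρ (rev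
-- d)` if it is: this is `tourStep ρ T`. The clockwise rotation of the dual is `facePerm = rot *
-- rev`, so exchanging `rot` for `facePerm` and `T` for its complement swaps the two cases and
-- inserts `rev` twice or not at all. The step is unchanged (`tourStep_facePerm`). In a spanning
-- tree the orbit from the starting dart runs through every dart exactly once
-- (`IsSpanningTree.exists_processes`). Hence the two traversals, which start at the same dart, are
-- equal as lists. The complement of `T` is a spanning tree of the dual: the orbit meets every dart
-- and each step stays in a face or crosses a non-tree edge, which gives connectedness; Euler's
-- formula then leaves too few edges for a cycle. In the traversal of the dual tree, an edge is
-- first met going down and then going up, so its occurrences are an opening and a closing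
-- parenthesis (`Processes.exists_subtrees`).

/-! Orbit segments. -/

/-- `l` lists the points `a, f a, f (f a), …` up to, but not including, `b`. -/
def IsOrbitSegment {α : Type*} (f : α → α) : α → List α → α → Prop
  | a, [], b => a = b
  | a, x :: l, b => x = a ∧ IsOrbitSegment f (f a) l b

namespace IsOrbitSegment

variable {α : Type*} {f : α → α}

theorem append {a b c : α} {l₁ l₂ : List α} (h₁ : IsOrbitSegment f a l₁ b)
    (h₂ : IsOrbitSegment f b l₂ c) : IsOrbitSegment f a (l₁ ++ l₂) c := by
  induction l₁ generalizing a with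
  | nil => obtain rfl : a = b := h₁; exact h₂
  | cons x l ih => exact ⟨h₁.1, ih h₁.2⟩

theorem getElem {a b : α} {l : List α} (h : IsOrbitSegment f a l b) (i : ℕ) (hi : i < l.length) :
    l[i] = f^[i] a := by
  induction l generalizing a i with
  | nil => simp at hi
  | cons x l ih =>
    cases i with
    | zero => exact h.1
    | succ i => simpa using ih h.2 i (by simpa using hi)

theorem eq_of_length_eq {a b b' : α} {l l' : List α} (h : IsOrbitSegment f a l b)
    (h' : IsOrbitSegment f a l' b') (hl : l.length = l'.length) : l = l' :=
  List.ext_getElem hl fun i hi hi' => by rw [h.getElem i hi, h'.getElem i hi']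

theorem map_range (f : α → α) (a : α) (n : ℕ) :
    IsOrbitSegment f a ((List.range n).map fun i => f^[i] a) (f^[n] a) := by
  induction n with
  | zero => rfl
  | succ n ih =>
    rw [List.range_succ, List.map_append]
    exact ih.append ⟨rfl, (Function.iterate_succ_apply' f n a).symm⟩

/-- An orbit segment of an injective function that does not come back to its first point has no
repetitions. -/
theorem nodup (hf : f.Injective) {a b : α} {l : List α} (h : IsOrbitSegment f a l b)
    (ha : a ∉ l.tail) : l.Nodup := by
  rw [List.Nodup, List.pairwise_iff_getElem]
  intro i j hi hj hij he
  rw [h.getElem, h.getElem] at he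
  obtain ⟨k, rfl⟩ : ∃ k, j = i + (k + 1) := ⟨j - i - 1, by omega⟩
  rw [Function.iterate_add_apply] at he
  have hk : k + 1 < l.length := by omega
  refine ha ?_
  -- Cancelling `f^[i]` in the repetition gives a return to `a` after `k + 1` steps.
  rw [hf.iterate i he, ← h.getElem (k + 1) hk, ← List.getElem_tail (by simp; omega)]
  exact List.getElem_mem _

end IsOrbitSegment

/-! The round of darts at a vertex. -/

section DartRound

variable {E : Type*}

@[simp]
theorem Dart.rev_rev (d : Dart E) : Dart.rev E (Dart.rev E d) = d := by
  simp [Dart.rev]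

@[simp]
theorem Dart.rev_fst (d : Dart E) : (Dart.rev E d).1 = d.1 := rfl

theorem Dart.eq_or_eq_rev {d d' : Dart E} (h : d.1 = d'.1) : d = d' ∨ d = Dart.rev E d' := by
  obtain ⟨e, b⟩ := d
  obtain ⟨e', b'⟩ := d'
  obtain rfl : e = e' := h
  cases b <;> cases b' <;> simp [Dart.rev]

variable (ρ : Equiv.Perm (Dart E)) (d : Dart E)

theorem isOrbitSegment_dartRound : IsOrbitSegment ρ d (dartRound ρ d) d := by
  simpa [dartRound] using IsOrbitSegment.map_range ρ d (Function.minimalPeriod ρ d)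

theorem nodup_dartRound : (dartRound ρ d).Nodup := by
  have := Function.nodup_periodicOrbit (f := ρ) (x := d)
  rwa [Function.periodicOrbit, Cycle.nodup_coe_iff] at this

variable [Finite E]

theorem mem_dartRound {ρ : Equiv.Perm (Dart E)} {d d' : Dart E} :
    d' ∈ dartRound ρ d ↔ ρ.SameCycle d d' := by
  have h : d ∈ Function.periodicPts ρ := ρ.injective.mem_periodicPts d
  have := Function.mem_periodicOrbit_iff (y := d') h
  rw [Function.periodicOrbit, Cycle.mem_coe_iff] at this
  refine this.trans ⟨?_, fun hs => ?_⟩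
  · rintro ⟨n, rfl⟩
    exact ⟨n, by simp [Equiv.Perm.iterate_eq_pow]⟩
  · obtain ⟨n, hn⟩ := hs.exists_nat_pow_eq
    exact ⟨n, by rwa [Equiv.Perm.iterate_eq_pow]⟩

theorem dartRound_eq_cons : dartRound ρ d = d :: (dartRound ρ d).tail := by
  have h := isOrbitSegment_dartRound ρ d
  have hd : d ∈ dartRound ρ d := mem_dartRound.2 (Equiv.Perm.SameCycle.refl _ _)
  cases hr : dartRound ρ d with
  | nil => simp [hr] at hd
  | cons x l => rw [hr] at h; rw [h.1, List.tail_cons]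

theorem isOrbitSegment_tail_dartRound :
    IsOrbitSegment ρ (ρ d) (dartRound ρ d).tail d := by
  have h := isOrbitSegment_dartRound ρ d
  rw [dartRound_eq_cons] at h
  exact h.2

theorem notMem_tail_dartRound : d ∉ (dartRound ρ d).tail := by
  have h := nodup_dartRound ρ d
  rw [dartRound_eq_cons] at h
  exact (List.nodup_cons.1 h).1

end DartRound

/-! General properties of traversals. -/

open Classical in
/-- The permutation that leads from each processed dart to the next one: after a dart of the tree,
the traversal continues at the other end of the edge. -/
noncomputable def tourStep {E : Type*} (ρ : Equiv.Perm (Dart E)) (T : Set E) (d : Dart E) :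
    Dart E :=
  if d.1 ∈ T then ρ (Dart.rev E d) else ρ d

/-- The case distinction depends only on the edge, which `rev` preserves, so values from different
cases never coincide. -/
theorem tourStep_injective {E : Type*} (ρ : Equiv.Perm (Dart E)) (T : Set E) :
    Function.Injective (tourStep ρ T) := by
  intro d d' h
  unfold tourStep at h
  split_ifs at h with h₁ h₂ h₂
  · exact (Dart.rev E).injective (ρ.injective h)
  · have := ρ.injective h
    rw [← this] at h₂
    exact absurd h₁ h₂
  · have := ρ.injective h
    rw [this] at h₁
    exact absurd h₂ h₁
  · exact ρ.injective h

namespace Processes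

variable {E : Type*} {ρ : Equiv.Perm (Dart E)} {T : Set E} {ds L : List (Dart E)}

theorem unique (h : Processes ρ T ds L) {L' : List (Dart E)} (h' : Processes ρ T ds L') :
    L = L' := by
  induction h generalizing L' with
  | nil => cases h'; rfl
  | skip hd _ ih =>
    cases h' with
    | skip _ hL => rw [ih hL]
    | visit hd' _ _ => exact absurd hd' hd
  | visit hd _ _ ih₁ ih₂ =>
    cases h' with
    | skip hd' _ => exact absurd hd hd'
    | visit _ h₁ h₂ => rw [ih₁ h₁, ih₂ h₂]

theorem subset (h : Processes ρ T ds L) : ds ⊆ L := by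
  induction h with
  | nil => simp
  | skip _ _ ih => exact List.cons_subset_cons _ ih
  | visit _ _ _ _ ih =>
    refine List.cons_subset_cons _ fun x hx => ?_
    simp [ih hx]

/-- Tree edges are processed from both ends. -/
theorem rev_mem (h : Processes ρ T ds L) : ∀ d ∈ L, d.1 ∈ T → Dart.rev E d ∈ L := by
  induction h with
  | nil => simp
  | skip hd _ ih =>
    intro x hx hxT
    rcases List.mem_cons.1 hx with rfl | hx
    · exact absurd hxT hd
    · exact List.mem_cons_of_mem _ (ih x hx hxT)
  | visit _ _ _ ih₁ ih₂ =>
    intro x hx hxT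
    simp only [List.mem_cons, List.mem_append] at hx ⊢
    rcases hx with rfl | hx | rfl | hx
    · simp
    · simp [ih₁ x hx hxT]
    · simp
    · simp [ih₂ x hx hxT]

/-- The recursion disappears: the round at a child ends at `rev d`, and since `rev (rev d) = d`, the
step from there leads to `ρ d`, the next dart at the parent. -/
theorem isOrbitSegment [Finite E] (h : Processes ρ T ds L) {a b : Dart E}
    (hds : IsOrbitSegment ρ a ds b) : IsOrbitSegment (tourStep ρ T) a L b := by
  induction h generalizing a b with
  | nil => exact hds
  | skip hd _ ih =>
    obtain ⟨rfl, hds⟩ := hds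
    exact ⟨rfl, by rw [tourStep, if_neg hd]; exact ih hds⟩
  | visit hd _ _ ih₁ ih₂ =>
    obtain ⟨rfl, hds⟩ := hds
    refine ⟨rfl, ?_⟩
    rw [tourStep, if_pos hd]
    refine (ih₁ (isOrbitSegment_tail_dartRound ρ _)).append ⟨rfl, ?_⟩
    rw [tourStep, if_pos (by exact hd), Dart.rev_rev]
    exact ih₂ hds

/-- At every vertex that the traversal enters, it processes all the darts. -/
theorem mem_or_dartRound_subset [Finite E] (h : Processes ρ T ds L) :
    ∀ d ∈ L, d ∈ ds ∨ ∀ d', ρ.SameCycle d d' → d' ∈ L := by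
  induction h with
  | nil => simp
  | skip _ _ ih =>
    intro x hx
    rcases List.mem_cons.1 hx with rfl | hx
    · simp
    · rcases ih x hx with h | h
      · simp [h]
      · exact Or.inr fun d' hd' => List.mem_cons_of_mem _ (h d' hd')
  | @visit d ds L₁ L₂ _ h₁ _ ih₁ ih₂ =>
    have key : ∀ x, ρ.SameCycle (Dart.rev E d) x →
        x ∈ d :: (L₁ ++ Dart.rev E d :: L₂) := by
      intro x hx
      rw [← mem_dartRound, dartRound_eq_cons, List.mem_cons] at hx
      rcases hx with rfl | hx
      · simp
      · simp [h₁.subset hx]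
    intro x hx
    simp only [List.mem_cons, List.mem_append] at hx
    rcases hx with rfl | hx | rfl | hx
    · simp
    · refine Or.inr fun d' hd' => ?_
      rcases ih₁ x hx with h | h
      · exact key _ ((mem_dartRound.1 (List.mem_of_mem_tail h)).trans hd')
      · simp [h d' hd']
    · exact Or.inr key
    · rcases ih₂ x hx with h | h
      · simp [h]
      · exact Or.inr fun d' hd' => by simp [h d' hd']

end Processes

namespace Subtrees

variable {E : Type*} {ρ : Equiv.Perm (Dart E)} {T : Set E} {ds : List (Dart E)}

theorem unique {ts ts' : List OrderedTree} (h : Subtrees ρ T ds ts) (h' : Subtrees ρ T ds ts') :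
    ts = ts' := by
  induction h generalizing ts' with
  | nil => cases h'; rfl
  | skip hd _ ih =>
    cases h' with
    | skip _ hs => exact ih hs
    | child hd' _ _ => exact absurd hd' hd
  | child hd _ _ ih₁ ih₂ =>
    cases h' with
    | skip hd' _ => exact absurd hd hd'
    | child _ h₁ h₂ => rw [ih₁ h₁, ih₂ h₂]

end Subtrees

/-! The parentheses of the tree and the traversal. -/

section Parens

variable {E : Type*}

theorem mem_dartsIn {S : Set E} {L : List (Dart E)} {d : Dart E} :
    d ∈ dartsIn S L ↔ d ∈ L ∧ d.1 ∈ S := by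
  simp [dartsIn]

theorem length_occurrenceBits (l : List E) : (occurrenceBits l).length = l.length := by
  simp [occurrenceBits]

theorem getElem_occurrenceBits {l : List E} {i : ℕ} (hi : i < (occurrenceBits l).length) :
    (occurrenceBits l)[i] = true ↔
      l[i]'(length_occurrenceBits l ▸ hi) ∈ l.take i := by
  simp [occurrenceBits]

theorem occurrenceBits_append {l₁ l₂ : List E} (h : l₁.Disjoint l₂) :
    occurrenceBits (l₁ ++ l₂) = occurrenceBits l₁ ++ occurrenceBits l₂ := by
  refine List.ext_getElem (by simp [length_occurrenceBits]) fun i hi hi' => ?_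
  rw [Bool.eq_iff_iff, getElem_occurrenceBits]
  rcases lt_or_ge i l₁.length with hl | hl
  · rw [List.getElem_append_left hl, List.getElem_append_left (by rwa [length_occurrenceBits]),
      getElem_occurrenceBits, List.take_append_of_le_length hl.le]
  · rw [List.getElem_append_right hl, List.getElem_append_right (by rwa [length_occurrenceBits]),
      getElem_occurrenceBits, List.take_append, List.take_of_length_le hl, List.mem_append]
    simp only [length_occurrenceBits]
    exact or_iff_right fun h₁ => h h₁ (List.getElem_mem _)

theorem occurrenceBits_cons_append_singleton {l : List E} {e : E} (h : e ∉ l) :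
    occurrenceBits (e :: (l ++ [e])) = false :: (occurrenceBits l ++ [true]) := by
  refine List.ext_getElem (by simp [length_occurrenceBits]) fun i hi hi' => ?_
  rw [Bool.eq_iff_iff, getElem_occurrenceBits]
  cases i with
  | zero => simp
  | succ i =>
    simp only [List.getElem_cons_succ, List.take_succ_cons]
    rcases lt_or_ge i l.length with hl | hl
    · rw [List.getElem_append_left hl, List.getElem_append_left (by rwa [length_occurrenceBits]),
        getElem_occurrenceBits, List.take_append_of_le_length hl.le, List.mem_cons]
      exact or_iff_right fun he => h (he ▸ List.getElem_mem _)
    · rw [List.getElem_append_right hl,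
        List.getElem_append_right (by rwa [length_occurrenceBits])]
      simp

/-- A visit along `d` contributes `d.1`, the block of the subtree and `d.1` again. Without repeated
darts, no edge is shared between this block and the rest, so the bits can be computed blockwise. -/
theorem Processes.exists_subtrees {ρ : Equiv.Perm (Dart E)} {S : Set E} {ds L : List (Dart E)}
    (h : Processes ρ S ds L) (hL : L.Nodup) : ∃ ts, Subtrees ρ S ds ts ∧
      OrderedTree.forestParens ts = occurrenceBits ((dartsIn S L).map Prod.fst) := by
  induction h with
  | nil => exact ⟨[], .nil, by simp [OrderedTree.forestParens, occurrenceBits, dartsIn]⟩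
  | skip hd _ ih =>
    obtain ⟨ts, hts, hb⟩ := ih (List.nodup_cons.1 hL).2
    exact ⟨ts, .skip hd hts, by simpa [dartsIn, hd] using hb⟩
  | @visit d ds L₁ L₂ hd h₁ h₂ ih₁ ih₂ =>
    rw [List.nodup_cons, List.nodup_append, List.nodup_cons] at hL
    obtain ⟨hdL, hL₁, ⟨hrL₂, hL₂⟩, hne⟩ := hL
    simp only [List.mem_append, List.mem_cons, not_or] at hdL
    obtain ⟨ts₁, hts₁, hb₁⟩ := ih₁ hL₁
    obtain ⟨ts₂, hts₂, hb₂⟩ := ih₂ hL₂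
    refine ⟨_, .child hd hts₁ hts₂, ?_⟩
    have hsplit : (dartsIn S (d :: (L₁ ++ Dart.rev E d :: L₂))).map Prod.fst =
        (d.1 :: ((dartsIn S L₁).map Prod.fst ++ [d.1])) ++ (dartsIn S L₂).map Prod.fst := by
      simp [dartsIn, hd]
    have hmem : ∀ {L : List (Dart E)} {e : E}, e ∈ (dartsIn S L).map Prod.fst →
        ∃ x ∈ L, x.1 ∈ S ∧ x.1 = e := by
      intro L e he
      obtain ⟨x, hx, rfl⟩ := List.mem_map.1 he
      exact ⟨x, (mem_dartsIn.1 hx).1, (mem_dartsIn.1 hx).2, rfl⟩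
    have hd₁ : d.1 ∉ (dartsIn S L₁).map Prod.fst := by
      intro he
      obtain ⟨x, hx, -, hxd⟩ := hmem he
      rcases Dart.eq_or_eq_rev hxd with rfl | rfl
      · exact hdL.1 hx
      · exact hne _ hx _ (by simp) rfl
    have hd₂ : d.1 ∉ (dartsIn S L₂).map Prod.fst := by
      intro he
      obtain ⟨x, hx, -, hxd⟩ := hmem he
      rcases Dart.eq_or_eq_rev hxd with rfl | rfl
      · exact hdL.2.2 hx
      · exact hrL₂ hx
    have hdisj : (d.1 :: ((dartsIn S L₁).map Prod.fst ++ [d.1])).Disjoint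
        ((dartsIn S L₂).map Prod.fst) := by
      intro e he he₂
      simp only [List.mem_cons, List.mem_append, List.not_mem_nil, or_false] at he
      rcases he with rfl | he | rfl
      · exact hd₂ he₂
      · obtain ⟨x, hx, hxS, hxe⟩ := hmem he
        obtain ⟨y, hy, -, hye⟩ := hmem he₂
        -- A tree edge met in `L₁` has both its darts there, so none is left for `L₂`.
        have hyL : y ∈ L₁ := by
          rcases Dart.eq_or_eq_rev (hye.trans hxe.symm) with rfl | rfl
          · exact hx
          · exact h₁.rev_mem x hx hxS
        exact hne y hyL y (by simp [hy]) rfl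
      · exact hd₂ he₂
    rw [hsplit, occurrenceBits_append hdisj, occurrenceBits_cons_append_singleton hd₁,
      OrderedTree.forestParens, OrderedTree.parens, hb₁, hb₂]

end Parens

/-! Existence of traversals. -/

namespace Multigraph

variable {V E : Type*} {G : Multigraph V E} {T : Set E}

/-- The darts of `q` form a walk along edges of `T` without repeated edges, leaving a new vertex at
every step. (Its last vertex is not required to be new.) -/
structure IsTrailIn (G : Multigraph V E) (T : Set E) (q : List (Dart E)) : Prop where
  chain : q.IsChain fun d d' => G.tgt d = G.src d'
  nodup_edges : (q.map Prod.fst).Nodup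
  nodup_src : (q.map G.src).Nodup
  mem : ∀ d ∈ q, d.1 ∈ T

namespace IsTrailIn

variable {q : List (Dart E)} {d d' : Dart E}

theorem singleton (h : d.1 ∈ T) : G.IsTrailIn T [d] :=
  ⟨List.isChain_singleton _, by simp, by simp, by simpa using h⟩

theorem suffix {q' : List (Dart E)} (hq : G.IsTrailIn T q) (h : q' <:+ q) : G.IsTrailIn T q' :=
  ⟨hq.chain.suffix h, (h.sublist.map _).nodup hq.nodup_edges, (h.sublist.map _).nodup hq.nodup_src,
    fun d hd => hq.mem d (h.subset hd)⟩

theorem length_le [Finite V] (hq : G.IsTrailIn T q) : q.length ≤ Nat.card V := by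
  have := Fintype.ofFinite V
  rw [Nat.card_eq_fintype_card, ← List.length_map G.src]
  exact hq.nodup_src.length_le_card

/-- In a forest, a trail does not close up. -/
theorem tgt_notMem (hT : ∀ l : List (Dart E), G.IsCycle l → ¬ ∀ d ∈ l, d.1 ∈ T)
    (hq : G.IsTrailIn T (q ++ [d])) : G.tgt d ∉ (q ++ [d]).map G.src := by
  intro h
  obtain ⟨z, hz, hzd⟩ := List.mem_map.1 h
  obtain ⟨s, t, hst⟩ := List.append_of_mem hz
  have hzt : G.IsTrailIn T (z :: t) := hq.suffix ⟨s, hst.symm⟩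
  -- The part of the trail from the revisited vertex onwards would be a cycle.
  refine hT (z :: t) ⟨by simp, ?_, hzt.nodup_edges, hzt.nodup_src⟩ hzt.mem
  rw [Cycle.chain_coe_cons, ← List.cons_append]
  refine hzt.chain.append (List.isChain_singleton _) ?_
  have hlast : (z :: t).getLast? = some d := by
    have := congrArg List.getLast? hst
    rw [List.getLast?_append_of_ne_nil _ (by simp)] at this
    simpa using this.symm
  intro x hx y hy
  obtain rfl : d = x := by simpa [hlast] using hx
  obtain rfl : z = y := by simpa using hy
  exact hzd.symm

theorem tgt_mem (hq : G.IsTrailIn T (q ++ [d])) (h : d' ∈ q) :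
    G.tgt d' ∈ (q ++ [d]).map G.src := by
  obtain ⟨s, t, rfl⟩ := List.append_of_mem h
  have hc : (d' :: (t ++ [d])).IsChain fun d d' => G.tgt d = G.src d' :=
    hq.chain.suffix ⟨s, by simp⟩
  cases t with
  | nil => simp [(List.isChain_cons_cons.1 hc).1]
  | cons x t => simp [(List.isChain_cons_cons.1 hc).1]

/-- The new dart leaves a new vertex. If it repeated an edge of the trail, it would leave the source
of that dart or its target; both are old, except for the target of the last dart, and that case is
turning back along `rev d`. -/
theorem append_singleton (hT : ∀ l : List (Dart E), G.IsCycle l → ¬ ∀ d ∈ l, d.1 ∈ T)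
    (hq : G.IsTrailIn T (q ++ [d])) (hd' : G.src d' = G.tgt d) (hne : d' ≠ Dart.rev E d)
    (hd'T : d'.1 ∈ T) : G.IsTrailIn T (q ++ [d] ++ [d']) := by
  have hnew : G.src d' ∉ (q ++ [d]).map G.src := hd' ▸ hq.tgt_notMem hT
  refine ⟨hq.chain.append (List.isChain_singleton _) ?_, ?_, ?_, ?_⟩
  · simp [hd']
  · rw [List.map_append, List.map_singleton, List.nodup_append_comm, List.singleton_append,
      List.nodup_cons]
    refine ⟨fun he => ?_, hq.nodup_edges⟩
    obtain ⟨z, hz, hzd⟩ := List.mem_map.1 he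
    rcases Dart.eq_or_eq_rev hzd.symm with rfl | rfl
    · exact hnew (List.mem_map_of_mem hz)
    · rcases List.mem_append.1 hz with hz | hz
      · exact hnew (hq.tgt_mem hz)
      · exact hne (by rw [List.mem_singleton.1 hz])
  · rw [List.map_append, List.map_singleton, List.nodup_append_comm, List.singleton_append,
      List.nodup_cons]
    exact ⟨hnew, hq.nodup_src⟩
  · intro x hx
    rcases List.mem_append.1 hx with hx | hx
    · exact hq.mem x hx
    · rw [List.mem_singleton.1 hx]
      exact hd'T

end IsTrailIn

open Classical in
/-- In a forest, a traversal that has arrived at `v` along the trail `q` can be completed, and does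
not come back to a vertex of the trail from below. -/
theorem exists_processes [Finite V] [Finite E] {ρ : Equiv.Perm (Dart E)}
    (hρ : ∀ d d' : Dart E, G.src d = G.src d' ↔ ρ.SameCycle d d')
    (hT : ∀ l : List (Dart E), G.IsCycle l → ¬ ∀ d ∈ l, d.1 ∈ T) (n : ℕ) :
    ∀ (q : List (Dart E)) (v : V) (ds : List (Dart E)), Nat.card V ≤ q.length + n →
      (∀ d ∈ ds, G.src d = v) → (∀ d ∈ ds, d.1 ∈ T → G.IsTrailIn T (q ++ [d])) →
      ∃ L, Processes ρ T ds L ∧ ∀ d, G.src d ∈ q.map G.src ++ [v] → L.count d = ds.count d := by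
  induction n with
  | zero =>
    intro q v ds hn hv hq
    induction ds with
    | nil => exact ⟨[], .nil, by simp⟩
    | cons x ds ih =>
      obtain ⟨L, hL, hc⟩ := ih (fun d hd => hv d (by simp [hd])) fun d hd => hq d (by simp [hd])
      by_cases hx : x.1 ∈ T
      -- The trail already has as many darts as there are vertices, so no tree dart can extend it.
      · have := (hq x (by simp) hx).length_le
        rw [List.length_append, List.length_singleton] at this
        omega
      · exact ⟨x :: L, .skip hx hL, fun d hd => by simp [List.count_cons, hc d hd]⟩
  | succ n ihn =>
    intro q v ds hn hv hq
    induction ds with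
    | nil => exact ⟨[], .nil, by simp⟩
    | cons x ds ih =>
      obtain ⟨L, hL, hc⟩ := ih (fun d hd => hv d (by simp [hd])) fun d hd => hq d (by simp [hd])
      by_cases hx : x.1 ∈ T
      · have hqx := hq x (by simp) hx
        have hxv := hv x (by simp)
        have hsrc : ∀ d ∈ (dartRound ρ (Dart.rev E x)).tail, G.src d = G.tgt x := fun d hd =>
          ((hρ _ _).2 (mem_dartRound.1 (List.mem_of_mem_tail hd))).symm
        obtain ⟨L₁, hL₁, hc₁⟩ := ihn (q ++ [x]) (G.tgt x) (dartRound ρ (Dart.rev E x)).tail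
          (by rw [List.length_append, List.length_singleton]; omega) hsrc
          fun d hd hdT => hqx.append_singleton hT (hsrc d hd)
            (fun he => notMem_tail_dartRound ρ _ (he ▸ hd)) hdT
        -- The child is a new vertex, so neither its subtree nor the way back processes a dart at a
        -- vertex of the trail or at `v`.
        refine ⟨_, .visit hx hL₁ hL, fun d hd => ?_⟩
        have hd' : G.src d ∈ (q ++ [x]).map G.src := by simpa [hxv] using hd
        have hnew := hqx.tgt_notMem hT
        have h₁ : L₁.count d = 0 := by
          rw [hc₁ d (List.mem_append_left _ hd'), List.count_eq_zero]
          exact fun hm => hnew (hsrc d hm ▸ hd')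
        have h₂ : Dart.rev E x ≠ d := by
          rintro rfl
          exact hnew hd'
        simp [List.count_cons, hc d hd, h₁, h₂]
      · exact ⟨x :: L, .skip hx hL, fun d hd => by simp [List.count_cons, hc d hd]⟩

theorem ReachableIn.mem_of_closed {S : Set V} {v w : V} (h : G.ReachableIn T v w) (hv : v ∈ S)
    (hS : ∀ d : Dart E, d.1 ∈ T → G.src d ∈ S → G.tgt d ∈ S) : w ∈ S := by
  induction h with
  | refl => exact hv
  | tail _ hs ih =>
    obtain ⟨d, hd, rfl, rfl⟩ := hs
    exact hS d hd ih

/-- The traversal of a spanning tree from any dart exists and processes all the darts, each once, in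
the order of `tourStep`. -/
theorem IsSpanningTree.exists_processes [Finite V] [Finite E] {ρ : Equiv.Perm (Dart E)}
    (hρ : ∀ d d' : Dart E, G.src d = G.src d' ↔ ρ.SameCycle d d') (hT : G.IsSpanningTree T)
    (d₀ : Dart E) :
    ∃ L, Processes ρ T (dartRound ρ d₀) L ∧ L.Nodup ∧ (∀ d, d ∈ L) ∧
      IsOrbitSegment (tourStep ρ T) d₀ L d₀ := by
  classical
  obtain ⟨L, hL, hc⟩ := Multigraph.exists_processes hρ hT.2 (Nat.card V) [] (G.src d₀)
    (dartRound ρ d₀) (by simp) (fun d hd => ((hρ _ _).2 (mem_dartRound.1 hd)).symm)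
    fun d _ hd => IsTrailIn.singleton hd
  have hseg := hL.isOrbitSegment (isOrbitSegment_dartRound ρ d₀)
  have hround : ∀ d ∈ L, ∀ d', G.src d = G.src d' → d' ∈ L := by
    intro d hd d' hdd'
    rcases hL.mem_or_dartRound_subset d hd with h | h
    · exact hL.subset (mem_dartRound.2 ((mem_dartRound.1 h).trans ((hρ _ _).1 hdd')))
    · exact h d' ((hρ _ _).1 hdd')
  have h₀ : d₀ ∈ L := hL.subset (mem_dartRound.2 (.refl _ _))
  -- The count at the root shows that the orbit does not meet `d₀` again, which excludes all
  -- repetitions. Completeness holds because the vertices with all darts processed are closed under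
  -- tree edges.
  refine ⟨L, hL, hseg.nodup (tourStep_injective ρ T) fun ht => ?_, fun d => ?_, hseg⟩
  · have hone : L.count d₀ = 1 := by
      rw [hc d₀ (by simp)]
      exact List.count_eq_one_of_mem (nodup_dartRound ρ d₀) (mem_dartRound.2 (.refl _ _))
    cases L with
    | nil => simp at h₀
    | cons x L =>
      obtain rfl : x = d₀ := hseg.1
      rw [List.count_cons_self, Nat.add_eq_right, List.count_eq_zero] at hone
      exact hone ht
  · have := (hT.1.2 (G.src d₀) (G.src d)).mem_of_closed
      (S := {v | ∀ d', G.src d' = v → d' ∈ L}) (fun d' hd' => hround d₀ h₀ d' hd'.symm) ?_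
    · exact this d rfl
    · intro x hxT hx d' hd'
      exact hround (Dart.rev E x) (hL.rev_mem x (hx x rfl) hxT) d' hd'.symm

end Multigraph

/-! Connectivity and the number of edges. -/

namespace Multigraph

variable {V E : Type*} {G : Multigraph V E} {S : Set E}

theorem ReachableIn.symm {v w : V} (h : G.ReachableIn S v w) : G.ReachableIn S w v := by
  induction h with
  | refl => exact .refl
  | tail _ hs ih =>
    obtain ⟨d, hd, rfl, rfl⟩ := hs
    exact ih.head ⟨Dart.rev E d, hd, rfl, by rw [tgt, Dart.rev_rev]⟩

theorem reachableIn_of_isChain {d d' : Dart E} {l : List (Dart E)}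
    (hl : (d :: (l ++ [d'])).IsChain fun x y => G.tgt x = G.src y) (hS : ∀ x ∈ l, x.1 ∈ S) :
    G.ReachableIn S (G.tgt d) (G.src d') := by
  induction l generalizing d with
  | nil => rw [(List.isChain_cons_cons.1 hl).1]; exact .refl
  | cons x l ih =>
    have h := List.isChain_cons_cons.1 hl
    rw [h.1]
    exact (ih h.2 fun y hy => hS y (List.mem_cons_of_mem _ hy)).head
      ⟨x, hS x List.mem_cons_self, rfl, rfl⟩

/-- Removing an edge of a cycle keeps a multigraph connected. -/
theorem ConnectedBy.diff_singleton (h : G.ConnectedBy S) {d : Dart E} {l : List (Dart E)}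
    (hc : G.IsCycle (d :: l)) (hl : ∀ x ∈ d :: l, x.1 ∈ S) : G.ConnectedBy (S \ {d.1}) := by
  have hd : G.ReachableIn (S \ {d.1}) (G.tgt d) (G.src d) := by
    refine reachableIn_of_isChain ((Cycle.chain_coe_cons _ _ _).1 hc.2.1) fun x hx =>
      ⟨hl x (List.mem_cons_of_mem _ hx), fun hxd => ?_⟩
    have := hc.2.2.1
    rw [List.map_cons, List.nodup_cons] at this
    exact this.1 (List.mem_map.2 ⟨x, hx, hxd⟩)
  refine ⟨h.1, fun v w => ?_⟩
  induction h.2 v w with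
  | refl => exact .refl
  | tail _ hs ih =>
    obtain ⟨x, hx, rfl, rfl⟩ := hs
    by_cases hxd : x.1 = d.1
    · rcases Dart.eq_or_eq_rev hxd with rfl | rfl
      · exact ih.trans hd.symm
      · rw [tgt, Dart.rev_rev]
        exact ih.trans hd
    · exact ih.tail ⟨x, ⟨hx, hxd⟩, rfl, rfl⟩

theorem ConnectedBy.card_le [Finite E] (h : G.ConnectedBy S) : Nat.card V ≤ S.ncard + 1 := by
  -- Dropping loops and merging parallel edges keeps the graph connected and does not increase the
  -- number of edges.
  let H : SimpleGraph V := SimpleGraph.fromRel fun v w =>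
    ∃ d : Dart E, d.1 ∈ S ∧ G.src d = v ∧ G.tgt d = w
  have hH : H.Connected := by
    have := h.1
    refine ⟨fun v w => ?_⟩
    induction h.2 v w with
    | refl => exact .refl _
    | @tail b c _ hs ih =>
      by_cases hbc : b = c
      · exact hbc ▸ ih
      · exact ih.trans (SimpleGraph.Adj.reachable ⟨hbc, Or.inl hs⟩)
  have hsub : H.edgeSet ⊆ (fun e => s(G.ends e false, G.ends e true)) '' S := by
    have key : ∀ d : Dart E, d.1 ∈ S →
        s(G.src d, G.tgt d) ∈ (fun e => s(G.ends e false, G.ends e true)) '' S := by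
      rintro ⟨e, b⟩ he
      refine ⟨e, he, ?_⟩
      cases b
      · rfl
      · exact Sym2.eq_swap
    intro p
    induction p with
    | _ v w =>
      rintro ⟨-, ⟨d, hd, rfl, rfl⟩ | ⟨d, hd, rfl, rfl⟩⟩
      · exact key d hd
      · rw [Sym2.eq_swap]
        exact key d hd
  calc Nat.card V ≤ H.edgeSet.ncard + 1 := hH.card_vert_le_card_edgeSet_add_one
    _ ≤ S.ncard + 1 := by
      gcongr
      exact (Set.ncard_le_ncard hsub (S.toFinite.image _)).trans (Set.ncard_image_le S.toFinite)

/-- A connected multigraph with at most one edge less than vertices is a tree. -/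
theorem ConnectedBy.isSpanningTree [Finite E] (h : G.ConnectedBy S)
    (hS : S.ncard + 1 ≤ Nat.card V) : G.IsSpanningTree S := by
  refine ⟨h, fun l hl hlS => ?_⟩
  cases l with
  | nil => exact hl.1 rfl
  | cons d l =>
    -- Without one edge of the cycle the graph would still be connected, with too few edges.
    have h₁ := (h.diff_singleton hl hlS).card_le
    have h₂ := Set.ncard_sdiff_singleton_lt_of_mem (hlS d List.mem_cons_self) S.toFinite
    omega

/-- This settles the degenerate case of a corner without darts: the graph is a single vertex. -/
theorem Connected.eq_of_isIsolated (h : G.Connected) {v : V} (hv : G.IsIsolated v) (w : V) :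
    w = v :=
  (h.2 v w).mem_of_closed (S := {v}) rfl fun d _ hd => absurd hd (hv d)

theorem Connected.isEmpty_of_isIsolated (h : G.Connected) {v : V} (hv : G.IsIsolated v) :
    IsEmpty E :=
  ⟨fun e => hv (e, false) (h.eq_of_isIsolated hv _)⟩

end Multigraph

/-! The dual tree. -/

namespace Embedding

variable {V E : Type*} {G : Multigraph V E} (M : Embedding G) {T : Set E}

/-- Seen from the dual, the traversals of a tree and of its complement move in the same way. -/
theorem tourStep_facePerm : tourStep M.facePerm Tᶜ = tourStep M.rot T := by
  funext d
  by_cases h : d.1 ∈ T <;> simp [tourStep, h, facePerm]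

instance [Finite V] [Finite E] : Finite M.Face :=
  inferInstanceAs (Finite (Quotient _ ⊕ {v : V // G.IsIsolated v}))

theorem rightFace_eq_iff (d d' : Dart E) :
    M.dualGraph.src d = M.dualGraph.src d' ↔ M.facePerm.SameCycle d d' :=
  (M.dual.src_eq_iff d d').trans Equiv.Perm.sameCycle_inv

theorem dual_rot_inv : M.dual.rot⁻¹ = M.facePerm := inv_inv _

/-- At a tree edge the step is `facePerm` and stays in the face; at a non-tree edge it crosses the
dual edge and then turns within the new face. -/
theorem reachableIn_tourStep (d : Dart E) :
    M.dualGraph.ReachableIn Tᶜ (M.dualGraph.src d) (M.dualGraph.src (tourStep M.rot T d)) := by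
  rw [← M.tourStep_facePerm, tourStep]
  split_ifs with h
  · refine .single ⟨d, h, rfl, ?_⟩
    rw [Multigraph.tgt, M.rightFace_eq_iff]
    exact Equiv.Perm.sameCycle_apply_right.2 (.refl _ _)
  · rw [(M.rightFace_eq_iff d (M.facePerm d)).2 (Equiv.Perm.sameCycle_apply_right.2 (.refl _ _))]
    exact .refl

theorem reachableIn_of_isOrbitSegment {a b : Dart E} {L : List (Dart E)}
    (h : IsOrbitSegment (tourStep M.rot T) a L b) :
    ∀ d ∈ L, M.dualGraph.ReachableIn Tᶜ (M.dualGraph.src a) (M.dualGraph.src d) := by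
  induction L generalizing a with
  | nil => simp
  | cons x L ih =>
    obtain ⟨rfl, h⟩ := h
    intro d hd
    rcases List.mem_cons.1 hd with rfl | hd
    · exact .refl
    · exact (M.reachableIn_tourStep x).trans (ih h d hd)

theorem connectedBy_compl [Finite V] [Finite E] (hG : G.Connected) (hT : G.IsSpanningTree T)
    (c : M.Corner) : M.dualGraph.ConnectedBy Tᶜ := by
  cases c with
  | inr v =>
    have := hG.isEmpty_of_isIsolated v.2
    have key : ∀ F : M.Face, F = Sum.inr v := by
      rintro (q | w)
      · induction q using Quotient.ind with
        | _ d => exact isEmptyElim d.1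
      · exact congrArg Sum.inr (Subtype.ext (hG.eq_of_isIsolated v.2 w.1))
    refine ⟨⟨Sum.inr v⟩, fun F F' => ?_⟩
    rw [key F, key F']
    exact .refl
  | inl d₀ =>
    obtain ⟨L, -, -, hmem, hseg⟩ := hT.exists_processes M.src_eq_iff d₀
    have key : ∀ F : M.Face, M.dualGraph.ReachableIn Tᶜ (M.dualGraph.src d₀) F := by
      rintro (q | w)
      · induction q using Quotient.ind with
        | _ d => exact M.reachableIn_of_isOrbitSegment hseg d (hmem d)
      · have := hG.isEmpty_of_isIsolated w.2
        exact isEmptyElim d₀.1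
    exact ⟨⟨M.dualGraph.src d₀⟩, fun F F' => (key F).symm.trans (key F')⟩

/-- In a planar embedding, the complement of a spanning tree is a spanning tree of the dual. -/
theorem isSpanningTree_compl [Finite V] [Finite E] (hG : G.Connected) (hM : M.IsPlanar)
    (hT : G.IsSpanningTree T) (c : M.Corner) : M.dualGraph.IsSpanningTree Tᶜ := by
  refine (M.connectedBy_compl hG hT c).isSpanningTree ?_
  -- As `T` has at least `|V| - 1` edges, Euler's formula leaves at most `|F| - 1` for the
  -- complement.
  have h₁ := hT.1.card_le
  have h₂ := Set.ncard_add_ncard_compl T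
  rw [IsPlanar] at hM
  omega

/-- The traversal of a spanning tree from a corner exists and processes every dart once. -/
theorem exists_isCcwTraversal [Finite V] [Finite E] (hG : G.Connected)
    (hT : G.IsSpanningTree T) (c : M.Corner) :
    ∃ L, M.IsCcwTraversal T c L ∧ L.Nodup ∧ ∀ d, d ∈ L := by
  cases c with
  | inr v =>
    have := hG.isEmpty_of_isIsolated v.2
    exact ⟨[], .nil, List.nodup_nil, fun d => isEmptyElim d.1⟩
  | inl d₀ =>
    obtain ⟨L, hL, hnd, hmem, -⟩ := hT.exists_processes M.src_eq_iff d₀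
    exact ⟨L, hL, hnd, hmem⟩

/-- The traversal of a spanning tree is the clockwise traversal of the complementary dual tree. -/
theorem IsCcwTraversal.dual [Finite V] [Finite E] {M : Embedding G} (hG : G.Connected)
    (hM : M.IsPlanar) (hT : G.IsSpanningTree T) {c : M.Corner} {L : List (Dart E)}
    (hL : M.IsCcwTraversal T c L) : M.dual.IsCwTraversal Tᶜ (M.dualCorner c) L := by
  have hT' := M.isSpanningTree_compl hG hM hT c
  cases c with
  | inr v =>
    cases hL
    exact .nil
  | inl d₀ =>
    obtain ⟨L₁, hL₁, hnd₁, hmem₁, hseg₁⟩ := hT.exists_processes M.src_eq_iff d₀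
    obtain ⟨L₂, hL₂, hnd₂, hmem₂, hseg₂⟩ := hT'.exists_processes M.rightFace_eq_iff d₀
    obtain rfl : L = L₁ := Processes.unique hL hL₁
    rw [M.tourStep_facePerm] at hseg₂
    obtain rfl : L = L₂ := hseg₁.eq_of_length_eq hseg₂
      ((List.perm_ext_iff_of_nodup hnd₁ hnd₂).2 fun d => by simp [hmem₁, hmem₂]).length_eq
    -- The dual corner is named by the dart on its counter-clockwise side, so the clockwise round
    -- starts one dart before, at `d₀` itself.
    have h₀ : M.facePerm (M.facePerm⁻¹ d₀) = d₀ := Equiv.apply_symm_apply _ _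
    rw [IsCwTraversal, dualCorner, cwFrom, M.dual_rot_inv, h₀]
    exact hL₂

end Embedding

/-- `G` is a finite connected multigraph with a planar embedding `M`, `T` is a spanning tree of `G`,
and `c` is any corner: the outer face is the face of `c` (any face may be the outer one), the root
of `T` is the vertex of `c`, and the traversal starts immediately after this incidence of the outer
face. The dual tree consists of the dual edges of the edges not in `T` and is rooted at the outer
face. -/
theorem lemma1 {V E : Type*} [Finite V] [Finite E] (G : Multigraph V E) (hG : G.Connected)
    (M : Embedding G) (hM : M.IsPlanar) (T : Set E) (hT : G.IsSpanningTree T) (c : M.Corner) :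
    -- the complementary dual edges form a spanning tree of the dual
    M.dualGraph.IsSpanningTree Tᶜ ∧
    -- the two traversals and the ordered dual tree exist and are unique
    (∃! L, M.IsCcwTraversal T c L) ∧
    (∃! L', M.dual.IsCwTraversal Tᶜ (M.dualCorner c) L') ∧
    (∃! t, M.dual.IsCwOrderedTree Tᶜ (M.dualCorner c) t) ∧
    ∀ (L L' : List (Dart E)) (t : OrderedTree),
      M.IsCcwTraversal T c L →
      M.dual.IsCwTraversal Tᶜ (M.dualCorner c) L' →
      M.dual.IsCwOrderedTree Tᶜ (M.dualCorner c) t →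
      -- the traversal of `T` processes every edge twice, once in each direction
      (L.Nodup ∧ ∀ d : Dart E, d ∈ L) ∧
      -- the non-tree edges met are, in this order, the dual edges crossed
      dartsIn Tᶜ L = dartsIn Tᶜ L' ∧
      -- the bits of the non-tree edges, enclosed by 0 and 1 for the root, encode the dual tree
      t.parens = false :: (occurrenceBits ((dartsIn Tᶜ L).map Prod.fst) ++ [true]) := by
  obtain ⟨L, hL, hnd, hmem⟩ := M.exists_isCcwTraversal hG hT c
  have hL' := hL.dual hG hM hT
  obtain ⟨ts, hts, hbits⟩ := Processes.exists_subtrees hL' hnd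
  refine ⟨M.isSpanningTree_compl hG hM hT c, ⟨L, hL, fun _ h => Processes.unique h hL⟩,
    ⟨L, hL', fun _ h => Processes.unique h hL'⟩, ⟨_, ⟨ts, hts, rfl⟩, ?_⟩, ?_⟩
  · rintro _ ⟨ts', hts', rfl⟩
    rw [hts'.unique hts]
  · rintro L₁ L₂ _ h₁ h₂ ⟨ts', hts', rfl⟩
    obtain rfl := Processes.unique h₁ hL
    obtain rfl := Processes.unique h₂ hL'
    obtain rfl := hts'.unique hts
    exact ⟨⟨hnd, hmem⟩, rfl, by rw [OrderedTree.parens, hbits]⟩
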